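/- All spaces are compactly generated and weakly Hausdorff, and products are formed in that category. Let $\mathcal{G}=(\partial\colon H\to G)$ be a topological crossed module, i.e. a continuous homomorphism of topological groups with a continuous left action of $G$ on $H$ by group automorphisms such that $\partial(\alpha(u))=\alpha\,\partial(u)\,\alpha^{-1}$ and $\partial(u)(v)=uvu^{-1}$. A morphism $\mathcal G\to\mathcal G'$ is a pair of continuous homomorphisms $H\to H'$, $G\to G'$ compatible with $\partial$ and with the actions. We also write $\mathcal{G}$ for the associated topological $2$-group: one object, $1$-morphisms $\alpha\in G$, and a $2$-morphism $\alpha\Rightarrow\partial(u)\alpha$ for each $(\alpha,u)\in G\rtimes H$; vertical composition is multiplication in $H$, and $(\alpha,u)\circ_h(\beta,v)=(\alpha\beta,\,u\,\alpha(v))$. Let $\Gamma$ be a discrete group. A $1$-cocycle on $\Gamma$ with values in $\mathcal{G}$ is a pair of maps $\alpha\colon\Gamma\to G$, $u\colon\Gamma\times\Gamma\to H$ with $\alpha_g\alpha_h=\partial(u_{g,h})\alpha_{gh}$ and $\alpha_g(u_{h,k})u_{g,hk}=u_{g,h}u_{gh,k}$. It is normalised if $\alpha_e=1$ and $u_{g,e}=u_{e,g}=1$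 for all $g$. Cocycles $(\alpha^{(0)},u^{(0)})$ and $(\alpha^{(1)},u^{(1)})$ are cohomologous if there are $\gamma\in G$ and $w\colon\Gamma\to H$ with $$\alpha^{(1)}_g=\partial(w_g)\,\gamma\,\alpha^{(0)}_g\,\gamma^{-1},\qquad u^{(1)}_{g,h}=w_g\,\gamma\big(\alpha^{(0)}_g(\gamma^{-1}(w_h))\,u^{(0)}_{g,h}\big)\,w_{gh}^{-1}.$$ Let $H^1(\Gamma,\mathcal{G})$ be the set of $1$-cocycles modulo this equivalence relation, pointed by the class of the trivial cocycle. Let $\mathcal{C}_\Gamma$ be the one-object category of $\Gamma$ and let $[n]$ be the category with a unique arrow $i\leftarrow j$ whenever $0\le i\le j\le n$; both are regarded as $2$-categories with only identity $2$-morphisms. Let $N_n(\mathcal{C}_\Gamma)$ be the discrete space of functors $[n]\to\mathcal{C}_\Gamma$, and let $N^D_n(\mathcal{G})$ be the space of strictly unital pseudofunctors $[n]\to\mathcal{G}$, topologised as a subspace of a product of copies of $G$ and $H$. Put $$B\Gamma=\lVert N_*(\mathcal{C}_\Gamma)\rVert,\qquad B^D\mathcal{G}=\lVert N^D_*(\mathcal{G})\rVert,$$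 where $\lVert X_*\rVert$ is the fat geometric realisation, i.e. the quotient of $\coprod_n X_n\times\Delta^n$ by the relations $(x,\varphi_*t)\sim(X(\varphi)x,t)$ for all injective monotone maps $\varphi$. Let $[X,Y]$ be the set of (free) homotopy classes of continuous maps. The set $[B\Gamma,B^D\mathcal{G}]$ is pointed by the class of the constant map at the unique $0$-simplex. A normalised cocycle $(\alpha,u)$ defines a strictly unital pseudofunctor $\theta_{(\alpha,u)}\colon\mathcal{C}_\Gamma\to\mathcal{G}$ with $g\mapsto\alpha_g$ and structure $2$-morphisms $u_{g,h}\colon\alpha_{gh}\Rightarrow\alpha_g\alpha_h$. Composition with it gives a map of simplicial spaces $N_*(\mathcal{C}_\Gamma)\to N^D_*(\mathcal{G})$, and hence a continuous map $\lVert N_*\theta_{(\alpha,u)}\rVert\colon B\Gamma\to B^D\mathcal{G}$. Then every class in $H^1(\Gamma,\mathcal{G})$ is represented by a normalised cocycle, cohomologous normalised cocycles induce homotopic maps $B\Gamma\to B^D\mathcal{G}$, and the resulting well-defined map $$H^1(\Gamma,\mathcal{G})\to[B\Gamma,B^D\mathcal{G}],\qquad [(\alpha,u)]\mapsto\big[\lVert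 N_*\theta_{(\alpha,u)}\rVert\big]\quad\text{for }(\alpha,u)\text{ normalised},$$ is a map of pointed sets which is natural in $\Gamma$ (with respect to group homomorphisms) and in $\mathcal{G}$ (with respect to morphisms of topological crossed modules). -/

import Mathlib

open CategoryTheory Opposite Topology

universe u

namespace XMod

/-! ### Compactly generated weakly Hausdorff spaces -/

/-- A space is weakly Hausdorff if every continuous image of a compact Hausdorff space in it is
closed. -/
class WeaklyHausdorff (X : Type u) [TopologicalSpace X] : Prop where
  isClosed_range : ∀ (K : Type u) [TopologicalSpace K] [CompactSpace K] [T2Space K] (f : K → X),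
    Continuous f → IsClosed (Set.range f)

/-- Joint continuity with respect to the product formed in the category of compactly generated
spaces, i.e. `X × Y` carries the compactly generated topology associated with the product
topology. -/
def KContinuous₂ {X Y Z : Type u} [TopologicalSpace X] [TopologicalSpace Y]
    [tZ : TopologicalSpace Z] (f : X → Y → Z) : Prop :=
  Continuous[TopologicalSpace.compactlyGenerated.{u} (X × Y), tZ] fun p => f p.1 p.2

theorem continuous_compactlyGenerated {X Y : Type u} [TopologicalSpace X] [TopologicalSpace Y]
    {f : X → Y} (hf : Continuous f) :
    Continuous[TopologicalSpace.compactlyGenerated.{u} X,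
      TopologicalSpace.compactlyGenerated.{u} Y] f := by
  refine @continuous_from_compactlyGenerated X Y _ (TopologicalSpace.compactlyGenerated.{u} Y) f ?_
  intro S g
  let F : (Σ (i : (S : CompHaus.{u}) × C(S, Y)), i.fst) → Y := fun ⟨⟨_, i⟩, s⟩ => i s
  have hF : @Continuous _ _ _ (TopologicalSpace.compactlyGenerated.{u} Y) F :=
    continuous_coinduced_rng
  let σ : S → Σ (i : (S : CompHaus.{u}) × C(S, Y)), i.fst :=
    Sigma.mk (β := fun i : (S : CompHaus.{u}) × C(S, Y) => i.fst)
      ⟨S, (⟨f, hf⟩ : C(X, Y)).comp g⟩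
  have hσ : Continuous σ := continuous_sigmaMk
  exact @Continuous.comp _ _ _ _ _ (TopologicalSpace.compactlyGenerated.{u} Y) σ F hF hσ

/-! ### Topological crossed modules -/

/-- A topological crossed module `∂ : H → G`. All spaces are compactly generated and weakly
Hausdorff, and products are formed among compactly generated spaces. The value of the left action
of `α : G` on `u : H` by group automorphisms is `α • u`. -/
structure CrossedModule where
  H : Type u
  G : Type u
  [groupH : Group H]
  [groupG : Group G]
  [topH : TopologicalSpace H]
  [topG : TopologicalSpace G]
  [cgH : CompactlyGeneratedSpace H]
  [cgG : CompactlyGeneratedSpace G]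
  [whH : WeaklyHausdorff H]
  [whG : WeaklyHausdorff G]
  [act : MulDistribMulAction G H]
  continuous_mulH : KContinuous₂ fun u v : H => u * v
  continuous_invH : Continuous fun u : H => u⁻¹
  continuous_mulG : KContinuous₂ fun α β : G => α * β
  continuous_invG : Continuous fun α : G => α⁻¹
  continuous_act : KContinuous₂ fun (α : G) (u : H) => α • u
  /-- The boundary homomorphism `∂`. -/
  bd : H →* G
  continuous_bd : Continuous bd
  bd_smul : ∀ (α : G) (u : H), bd (α • u) = α * bd u * α⁻¹
  bd_act : ∀ u v : H, bd u • v = u * v * u⁻¹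

attribute [instance] CrossedModule.groupH CrossedModule.groupG CrossedModule.topH
  CrossedModule.topG CrossedModule.cgH CrossedModule.cgG CrossedModule.whH CrossedModule.whG
  CrossedModule.act

/-- A morphism of topological crossed modules. -/
structure CrossedModule.Hom (𝒢 𝒢' : CrossedModule.{u}) where
  homH : 𝒢.H →* 𝒢'.H
  homG : 𝒢.G →* 𝒢'.G
  continuous_homH : Continuous homH
  continuous_homG : Continuous homG
  bd_comp : ∀ u : 𝒢.H, 𝒢'.bd (homH u) = homG (𝒢.bd u)
  map_smul : ∀ (α : 𝒢.G) (u : 𝒢.H), homH (α • u) = homG α • homH u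

/-! ### First cohomology -/

/-- A `1`-cocycle on `Γ` with values in `𝒢`. -/
@[ext]
structure Cocycle (Γ : Type u) [Group Γ] (𝒢 : CrossedModule.{u}) where
  α : Γ → 𝒢.G
  u : Γ → Γ → 𝒢.H
  mul_eq : ∀ g h, α g * α h = 𝒢.bd (u g h) * α (g * h)
  assoc : ∀ g h k, α g • u h k * u g (h * k) = u g h * u (g * h) k

variable {Γ Γ' : Type u} [Group Γ] [Group Γ'] {𝒢 𝒢' : CrossedModule.{u}}

namespace Cocycle

/-- A cocycle is normalised if `α_e = 1` and `u_{g,e} = u_{e,g} = 1`. -/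
def Normalised (c : Cocycle Γ 𝒢) : Prop :=
  c.α 1 = 1 ∧ (∀ g, c.u g 1 = 1) ∧ ∀ g, c.u 1 g = 1

/-- Two cocycles are cohomologous if they are related by some `γ : G` and `w : Γ → H`. -/
def Cohomologous (c₀ c₁ : Cocycle Γ 𝒢) : Prop :=
  ∃ (γ : 𝒢.G) (w : Γ → 𝒢.H),
    (∀ g, c₁.α g = 𝒢.bd (w g) * γ * c₀.α g * γ⁻¹) ∧
    ∀ g h, c₁.u g h = w g * γ • (c₀.α g • γ⁻¹ • w h * c₀.u g h) * (w (g * h))⁻¹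

theorem Cohomologous.refl (c : Cocycle Γ 𝒢) : Cohomologous c c :=
  ⟨1, fun _ => 1, by simp, by simp⟩

theorem Cohomologous.symm {c₀ c₁ : Cocycle Γ 𝒢} (h : Cohomologous c₀ c₁) :
    Cohomologous c₁ c₀ := by
  obtain ⟨γ, w, h1, h2⟩ := h
  refine ⟨γ⁻¹, fun g => γ⁻¹ • (w g)⁻¹, fun g => ?_, fun g h => ?_⟩
  · rw [𝒢.bd_smul, h1, map_inv]
    group
  · rw [h1, h2]
    simp only [mul_smul, smul_mul', smul_inv', inv_inv, 𝒢.bd_act, smul_inv_smul, inv_smul_smul]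
    group

theorem Cohomologous.trans {c₀ c₁ c₂ : Cocycle Γ 𝒢} (h : Cohomologous c₀ c₁)
    (h' : Cohomologous c₁ c₂) : Cohomologous c₀ c₂ := by
  obtain ⟨γ, w, h1, h2⟩ := h
  obtain ⟨δ, v, h3, h4⟩ := h'
  refine ⟨δ * γ, fun g => v g * δ • w g, fun g => ?_, fun g h => ?_⟩
  · rw [h3, h1, map_mul, 𝒢.bd_smul]
    group
  · rw [h4, h1, h2]
    simp only [mul_smul, smul_mul', smul_inv', mul_inv_rev, 𝒢.bd_act, inv_smul_smul]
    group

instance setoid (Γ : Type u) [Group Γ] (𝒢 : CrossedModule.{u}) : Setoid (Cocycle Γ 𝒢) :=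
  ⟨Cohomologous, Cohomologous.refl, Cohomologous.symm, Cohomologous.trans⟩

/-- The trivial cocycle. -/
def trivial (Γ : Type u) [Group Γ] (𝒢 : CrossedModule.{u}) : Cocycle Γ 𝒢 where
  α _ := 1
  u _ _ := 1
  mul_eq := by simp
  assoc := by simp

/-- Restriction of a cocycle along a group homomorphism. -/
def pullback (φ : Γ' →* Γ) (c : Cocycle Γ 𝒢) : Cocycle Γ' 𝒢 where
  α g := c.α (φ g)
  u g h := c.u (φ g) (φ h)
  mul_eq g h := by simp only [map_mul, c.mul_eq]
  assoc g h k := by simp only [map_mul, c.assoc]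

/-- Image of a cocycle under a morphism of crossed modules. -/
def map (Φ : CrossedModule.Hom 𝒢 𝒢') (c : Cocycle Γ 𝒢) : Cocycle Γ 𝒢' where
  α g := Φ.homG (c.α g)
  u g h := Φ.homH (c.u g h)
  mul_eq g h := by simp only [← map_mul, c.mul_eq, Φ.bd_comp]
  assoc g h k := by simp only [← map_mul, ← c.assoc, ← Φ.map_smul]

end Cocycle

/-- The first cohomology `H¹(Γ, 𝒢)`, the set of all cocycles modulo being cohomologous. -/
def H1 (Γ : Type u) [Group Γ] (𝒢 : CrossedModule.{u}) : Type u :=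
  Quotient (Cocycle.setoid Γ 𝒢)

namespace H1

/-- The cohomology class of a cocycle. -/
def mk (c : Cocycle Γ 𝒢) : H1 Γ 𝒢 := Quotient.mk _ c

/-- The distinguished point: the class of the trivial cocycle. -/
def basepoint (Γ : Type u) [Group Γ] (𝒢 : CrossedModule.{u}) : H1 Γ 𝒢 := mk (Cocycle.trivial Γ 𝒢)

/-- Functoriality of `H¹(Γ, 𝒢)` in `Γ`. -/
def pullback (φ : Γ' →* Γ) : H1 Γ 𝒢 → H1 Γ' 𝒢 :=
  Quotient.map (Cocycle.pullback φ) (by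
    rintro c₀ c₁ ⟨γ, w, h1, h2⟩
    refine ⟨γ, fun g => w (φ g), fun g => h1 (φ g), fun g h => ?_⟩
    simp only [Cocycle.pullback, map_mul, h2])

/-- Functoriality of `H¹(Γ, 𝒢)` in `𝒢`. -/
def map (Φ : CrossedModule.Hom 𝒢 𝒢') : H1 Γ 𝒢 → H1 Γ 𝒢' :=
  Quotient.map (Cocycle.map Φ) (by
    rintro c₀ c₁ ⟨γ, w, h1, h2⟩
    refine ⟨Φ.homG γ, fun g => Φ.homH (w g), fun g => ?_, fun g h => ?_⟩
    · simp only [Cocycle.map, h1, map_mul, map_inv, Φ.bd_comp]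
    · simp only [Cocycle.map, h2, map_mul, map_inv, Φ.map_smul])

end H1

/-! ### Pseudofunctors into the `2`-group of a crossed module -/

/-- A strictly unital pseudofunctor from a category `C` (a `2`-category with only identity
`2`-morphisms) to the `2`-group of `𝒢`. That `2`-group has one object, the elements of `G` as
`1`-morphisms, composed by multiplication, and an element `u : H` gives a `2`-morphism
`α ⟹ ∂(u) α` for each `α : G`; vertical composition is multiplication in `H`, and the horizontal
composite of `u : α ⟹ ∂(u) α` and `v : β ⟹ ∂(v) β` is `u * α • v`.
The pseudofunctor sends `f` to `map f`, and for `f : x ⟶ y`, `g : y ⟶ z` the structure `2`-morphism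
`η_{g,f} : θ(g ∘ f) ⟹ θ(g) ∘ θ(f)` is given by `η f g`. -/
@[ext]
structure Pseudofun (C : Type*) [Category C] (𝒢 : CrossedModule.{u}) where
  map : ∀ {x y : C}, (x ⟶ y) → 𝒢.G
  η : ∀ {x y z : C}, (x ⟶ y) → (y ⟶ z) → 𝒢.H
  map_id : ∀ x : C, map (𝟙 x) = 1
  target : ∀ {x y z : C} (f : x ⟶ y) (g : y ⟶ z), map g * map f = 𝒢.bd (η f g) * map (f ≫ g)
  assoc : ∀ {x y z w : C} (f : x ⟶ y) (g : y ⟶ z) (h : z ⟶ w),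
    map h • η f g * η (f ≫ g) h = η g h * η f (g ≫ h)
  id_η : ∀ {x y : C} (f : x ⟶ y), η (𝟙 x) f = 1
  η_id : ∀ {x y : C} (f : x ⟶ y), η f (𝟙 y) = 1

namespace Pseudofun

/-- Composition of a functor with a pseudofunctor. -/
def precomp {C D : Type*} [Category C] [Category D] (F : C ⥤ D) (θ : Pseudofun D 𝒢) :
    Pseudofun C 𝒢 where
  map f := θ.map (F.map f)
  η f g := θ.η (F.map f) (F.map g)
  map_id x := by rw [F.map_id, θ.map_id]
  target f g := by rw [F.map_comp, θ.target]
  assoc f g h := by rw [F.map_comp, F.map_comp, θ.assoc]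
  id_η f := by rw [F.map_id, θ.id_η]
  η_id f := by rw [F.map_id, θ.η_id]

/-- Composition of a pseudofunctor with the strict `2`-functor given by a morphism of crossed
modules. -/
def postcomp {C : Type*} [Category C] (Φ : CrossedModule.Hom 𝒢 𝒢') (θ : Pseudofun C 𝒢) :
    Pseudofun C 𝒢' where
  map f := Φ.homG (θ.map f)
  η f g := Φ.homH (θ.η f g)
  map_id x := by rw [θ.map_id, map_one]
  target f g := by rw [← map_mul, θ.target, map_mul, Φ.bd_comp]
  assoc f g h := by rw [← Φ.map_smul, ← map_mul, θ.assoc, map_mul]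
  id_η f := by rw [θ.id_η, map_one]
  η_id f := by rw [θ.η_id, map_one]

/-- The constant pseudofunctor. -/
def const (C : Type*) [Category C] (𝒢 : CrossedModule.{u}) : Pseudofun C 𝒢 where
  map _ := 1
  η _ _ := 1
  map_id _ := rfl
  target := by simp
  assoc := by simp
  id_η _ := rfl
  η_id _ := rfl

/-- The strictly unital pseudofunctor `θ_{(α,u)} : C_Γ → 𝒢` of a normalised cocycle, where `C_Γ` is
`Γ` regarded as a category with one object. -/
def ofCocycle (c : Cocycle Γ 𝒢) (hc : c.Normalised) : Pseudofun (SingleObj Γ) 𝒢 where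
  map g := c.α g
  η h g := c.u g h
  map_id _ := hc.1
  target h g := c.mul_eq g h
  assoc k h g := c.assoc g h k
  id_η g := hc.2.1 g
  η_id g := hc.2.2 g

end Pseudofun

/-- The category `[n]`, with a unique arrow `i ← j` if and only if `i ≤ j`. -/
abbrev Ord (n : SimplexCategory) : Type := (Fin (n.len + 1))ᵒᵈ

/-- The functor `[m] ⥤ [n]` given by a monotone map. -/
def ordFunctor {m n : SimplexCategory} (f : m ⟶ n) : Ord m ⥤ Ord n :=
  f.toOrderHom.dual.monotone.functor

/-! ### Nerves -/

/-- The values of a pseudofunctor `[n] → 𝒢`, as a point of a product of copies of `G` and `H`. -/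
def coords (n : SimplexCategory) (𝒢 : CrossedModule.{u}) (θ : Pseudofun (Ord n) 𝒢) :
    ((p : Σ (x y : Ord n), x ⟶ y) → 𝒢.G) ×
      ((p : Σ (x y z : Ord n), (x ⟶ y) × (y ⟶ z)) → 𝒢.H) :=
  (fun p => θ.map p.2.2, fun p => θ.η p.2.2.2.1 p.2.2.2.2)

/-- The subspace topology on pseudofunctors `[n] → 𝒢` inside the ordinary product. -/
abbrev subspaceTopology (n : SimplexCategory) (𝒢 : CrossedModule.{u}) :
    TopologicalSpace (Pseudofun (Ord n) 𝒢) :=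
  TopologicalSpace.induced (coords n 𝒢) inferInstance

/-- Pseudofunctors `[n] → 𝒢` form a subspace of a product of copies of `G` and `H`, where subspaces
and products are formed among compactly generated spaces. -/
instance (n : SimplexCategory) (𝒢 : CrossedModule.{u}) :
    TopologicalSpace (Pseudofun (Ord n) 𝒢) :=
  @TopologicalSpace.compactlyGenerated.{u} _ (subspaceTopology n 𝒢)

theorem continuous_precomp {m n : SimplexCategory} (f : m ⟶ n) (𝒢 : CrossedModule.{u}) :
    Continuous (Pseudofun.precomp (ordFunctor f) : Pseudofun (Ord n) 𝒢 → Pseudofun (Ord m) 𝒢) := by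
  let := subspaceTopology m 𝒢
  let := subspaceTopology n 𝒢
  refine continuous_compactlyGenerated ?_
  have h : Continuous (coords n 𝒢) := continuous_induced_dom
  refine continuous_induced_rng.2 (Continuous.prodMk (continuous_pi fun p => ?_)
    (continuous_pi fun p => ?_))
  · exact (continuous_apply (⟨_, _, (ordFunctor f).map p.2.2⟩ : Σ (x y : Ord n), x ⟶ y)).comp
      (continuous_fst.comp h)
  · exact (continuous_apply (⟨_, _, _, (ordFunctor f).map p.2.2.2.1, (ordFunctor f).map p.2.2.2.2⟩ :
      Σ (x y z : Ord n), (x ⟶ y) × (y ⟶ z))).comp (continuous_snd.comp h)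

theorem continuous_postcomp (n : SimplexCategory) (Φ : CrossedModule.Hom 𝒢 𝒢') :
    Continuous (Pseudofun.postcomp Φ : Pseudofun (Ord n) 𝒢 → Pseudofun (Ord n) 𝒢') := by
  let := subspaceTopology n 𝒢
  let := subspaceTopology n 𝒢'
  refine continuous_compactlyGenerated ?_
  have h : Continuous (coords n 𝒢) := continuous_induced_dom
  refine continuous_induced_rng.2 (Continuous.prodMk (continuous_pi fun p => ?_)
    (continuous_pi fun p => ?_))
  · exact Φ.continuous_homG.comp ((continuous_apply p).comp (continuous_fst.comp h))
  · exact Φ.continuous_homH.comp ((continuous_apply p).comp (continuous_snd.comp h))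

/-- The Duskin nerve of `𝒢`, a simplicial space. -/
def duskinNerve (𝒢 : CrossedModule.{u}) : SimplicialObject TopCat.{u} where
  obj n := TopCat.of (Pseudofun (Ord n.unop) 𝒢)
  map f := TopCat.ofHom ⟨Pseudofun.precomp (ordFunctor f.unop), continuous_precomp f.unop 𝒢⟩
  map_id _ := rfl
  map_comp _ _ := rfl

/-- Functoriality of the Duskin nerve. -/
def duskinNerveMap (Φ : CrossedModule.Hom 𝒢 𝒢') : duskinNerve 𝒢 ⟶ duskinNerve 𝒢' where
  app n := TopCat.ofHom ⟨Pseudofun.postcomp Φ, continuous_postcomp n.unop Φ⟩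
  naturality _ _ _ := rfl

/-- The nerve of the category `C_Γ` of the discrete group `Γ`, a simplicial (discrete) space. -/
def nerveGroup (Γ : Type u) [Group Γ] : SimplicialObject TopCat.{u} where
  obj n := @TopCat.of (Ord n.unop ⥤ SingleObj Γ) ⊥
  map f := @TopCat.ofHom _ _ ⊥ ⊥ <|
    @ContinuousMap.mk _ _ ⊥ ⊥ (fun σ => ordFunctor f.unop ⋙ σ) continuous_bot
  map_id _ := rfl
  map_comp _ _ := rfl

/-- Functoriality of the nerve of a discrete group. -/
def nerveGroupMap (φ : Γ' →* Γ) : nerveGroup Γ' ⟶ nerveGroup Γ where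
  app _ := @TopCat.ofHom _ _ ⊥ ⊥ <|
    @ContinuousMap.mk _ _ ⊥ ⊥ (fun σ => σ ⋙ φ.toFunctor) continuous_bot
  naturality _ _ _ := rfl

/-- Composition with a pseudofunctor `C_Γ → 𝒢` as a morphism of simplicial spaces. -/
def nerveOfPseudofun (θ : Pseudofun (SingleObj Γ) 𝒢) : nerveGroup Γ ⟶ duskinNerve 𝒢 where
  app _ := @TopCat.ofHom _ _ ⊥ _ <|
    @ContinuousMap.mk _ _ ⊥ _ (fun σ => Pseudofun.precomp σ θ) continuous_bot
  naturality _ _ _ := rfl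

/-! ### Fat geometric realisation -/

/-- The disjoint union of the spaces `X_n × Δⁿ`. -/
abbrev PreRealisation (X : SimplicialObject TopCat.{u}) : Type u :=
  Σ n : ℕ, X.obj (op (.mk n)) × stdSimplex ℝ (Fin (n + 1))

/-- The relations `(x, φ_* t) ∼ (X(φ) x, t)` for injective monotone maps `φ : [m] → [n]`. -/
inductive FatRel (X : SimplicialObject TopCat.{u}) : PreRealisation X → PreRealisation X → Prop
  | face {m n : ℕ} (φ : SimplexCategory.mk m ⟶ SimplexCategory.mk n) (hφ : Function.Injective φ.toOrderHom)
      (x : X.obj (op (.mk n))) (t : stdSimplex ℝ (Fin (m + 1))) :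
      FatRel X ⟨n, x, stdSimplex.map φ.toOrderHom t⟩ ⟨m, X.map φ.op x, t⟩

/-- The fat geometric realisation `‖X‖`, with the quotient topology. -/
def FatRealisation (X : SimplicialObject TopCat.{u}) : Type u := Quot (FatRel X)

instance (X : SimplicialObject TopCat.{u}) : TopologicalSpace (FatRealisation X) :=
  inferInstanceAs (TopologicalSpace (Quot (FatRel X)))

/-- The point of `‖X‖` given by a simplex and a point of the standard simplex. -/
def FatRealisation.mk {X : SimplicialObject TopCat.{u}} {n : ℕ} (x : X.obj (op (.mk n)))
    (t : stdSimplex ℝ (Fin (n + 1))) : FatRealisation X := Quot.mk _ ⟨n, x, t⟩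

/-- The continuous map `‖f‖ : ‖X‖ → ‖Y‖` induced by a simplicial map. -/
def fatMap {X Y : SimplicialObject TopCat.{u}} (f : X ⟶ Y) :
    C(FatRealisation X, FatRealisation Y) where
  toFun := Quot.map (fun p => ⟨p.1, f.app _ p.2.1, p.2.2⟩) (by
    rintro _ _ ⟨φ, hφ, x, t⟩
    have h := ConcreteCategory.congr_hom (f.naturality φ.op) x
    simp only [TopCat.hom_comp, ContinuousMap.comp_apply] at h
    simp only [h]
    exact FatRel.face φ hφ _ t)
  continuous_toFun := by
    refine continuous_quot_lift _ (continuous_quot_mk.comp ?_)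
    refine continuous_sigma fun n => continuous_sigmaMk.comp ?_
    exact ((f.app (op (.mk n))).hom.continuous.comp continuous_fst).prodMk continuous_snd

/-- The classifying space `BΓ = ‖N_*(C_Γ)‖` of a discrete group. -/
abbrev B (Γ : Type u) [Group Γ] : Type u := FatRealisation (nerveGroup Γ)

/-- The classifying space `B^D 𝒢 = ‖N^D_*(𝒢)‖` of a crossed module. -/
abbrev BD (𝒢 : CrossedModule.{u}) : Type u := FatRealisation (duskinNerve 𝒢)

/-- The base point of `B^D 𝒢`: the unique `0`-simplex of the Duskin nerve. -/
def BD.basepoint (𝒢 : CrossedModule.{u}) : BD 𝒢 :=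
  FatRealisation.mk (X := duskinNerve 𝒢) (n := 0) (Pseudofun.const (Ord (.mk 0)) 𝒢) default

/-- The map `BΓ' → BΓ` induced by a group homomorphism. -/
def B.map (φ : Γ' →* Γ) : C(B Γ', B Γ) := fatMap (nerveGroupMap φ)

/-- The map `B^D 𝒢 → B^D 𝒢'` induced by a morphism of crossed modules. -/
def BD.map (Φ : CrossedModule.Hom 𝒢 𝒢') : C(BD 𝒢, BD 𝒢') := fatMap (duskinNerveMap Φ)

/-- The map `BΓ → B^D 𝒢` obtained by realising the nerve of the pseudofunctor of a normalised
cocycle. -/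
def realise (c : Cocycle Γ 𝒢) (hc : c.Normalised) : C(B Γ, BD 𝒢) :=
  fatMap (nerveOfPseudofun (Pseudofun.ofCocycle c hc))

/-! ### Homotopy sets -/

/-- The set `[X, Y]` of homotopy classes of continuous maps. -/
def HomotopySet (X Y : Type u) [TopologicalSpace X] [TopologicalSpace Y] : Type u :=
  Quotient (⟨ContinuousMap.Homotopic, ContinuousMap.Homotopic.equivalence⟩ : Setoid C(X, Y))

namespace HomotopySet

variable {X X' Y Y' : Type u} [TopologicalSpace X] [TopologicalSpace X'] [TopologicalSpace Y]
  [TopologicalSpace Y']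

/-- The homotopy class of a continuous map. -/
def mk (f : C(X, Y)) : HomotopySet X Y := Quotient.mk _ f

/-- The distinguished point of `[X, Y]` for a pointed space `(Y, y)`: the class of the constant
map. -/
def const (X : Type u) [TopologicalSpace X] (y : Y) : HomotopySet X Y :=
  mk (ContinuousMap.const X y)

/-- Precomposition `[X, Y] → [X', Y]` with a continuous map. -/
def precomp (p : C(X', X)) : HomotopySet X Y → HomotopySet X' Y :=
  Quotient.map (fun f => f.comp p) fun _ _ h => h.comp (ContinuousMap.Homotopic.refl p)

/-- Postcomposition `[X, Y] → [X, Y']` with a continuous map. -/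
def postcomp (q : C(Y, Y')) : HomotopySet X Y → HomotopySet X Y' :=
  Quotient.map (fun f => q.comp f) fun _ _ h => (ContinuousMap.Homotopic.refl q).comp h

end HomotopySet

end XMod

namespace XMod

variable {Γ Γ' : Type u} [Group Γ] [Group Γ'] {𝒢 𝒢' : CrossedModule.{u}}

/-! ### Straight-line homotopies between realised simplicial maps -/

/-! The substance is a homotopy that works in a fat realisation, where degenerate simplices are not
collapsed. Let `(γ, w)` relate two normalised cocycles `c₀` and `c₁`. To an `n`-simplex `σ` of the
nerve of `Γ` one assigns a `(2n+1)`-simplex of the Duskin nerve: each vertex `i` is doubled to `2i`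
and `2i+1`, `σ` is pulled back along the map merging them, and the pseudofunctor of `c₀` on it is
gauge transformed by `(γ, w)` at the odd vertices only (`mixedSimplex`). Such partial transforms
exist because gauge data are free: any `γ` on objects and any `w` on arrows will do, provided `w` is
`1` on identities (`Pseudofun.gauge`). The even face is the simplex of `c₀` and the odd face that of
`c₁`, so sliding `Δⁿ` along straight segments from one face to the other gives the homotopy
(`homotopic_of_segments`). The pieces glue because doubling is functorial for injective monotone
maps, the only ones occurring in the gluing relations.

The trivial cocycle does not realise to a constant map on the nose: it sends each simplex to a
constant simplex of the same dimension. Coning off with one further last vertex and sliding to the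
apex contracts it to the base point.

Every class has a normalised representative because twisting by the inverse of `u 1 1` removes all
failures of normalisation. For normalised representatives naturality is an equality of maps, not
merely a homotopy. -/

/-- The point of the standard simplex at time `s` on the segment from `p` to `q`. -/
def segment {ι : Type*} [Fintype ι] (s : unitInterval) (p q : stdSimplex ℝ ι) : stdSimplex ℝ ι :=
  ⟨(1 - s : ℝ) • (p : ι → ℝ) + (s : ℝ) • (q : ι → ℝ),
    convex_stdSimplex ℝ ι p.2 q.2 (sub_nonneg.2 s.2.2) s.2.1 (by ring)⟩

theorem segment_zero {ι : Type*} [Fintype ι] (p q : stdSimplex ℝ ι) : segment 0 p q = p :=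
  Subtype.ext (by simp [segment]; rfl)

theorem segment_one {ι : Type*} [Fintype ι] (p q : stdSimplex ℝ ι) : segment 1 p q = q :=
  Subtype.ext (by simp [segment]; rfl)

theorem continuous_segment {ι : Type*} [Fintype ι] :
    Continuous fun x : unitInterval × stdSimplex ℝ ι × stdSimplex ℝ ι =>
      segment x.1 x.2.1 x.2.2 := by
  unfold segment
  fun_prop

/-- The map of simplices induced by a vertex map is the restriction of a linear map. -/
theorem map_segment {ι κ : Type*} [Fintype ι] [Fintype κ] (f : ι → κ) (s : unitInterval)
    (p q : stdSimplex ℝ ι) :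
    stdSimplex.map f (segment s p q) = segment s (stdSimplex.map f p) (stdSimplex.map f q) :=
  Subtype.ext <| by
    change FunOnFinite.linearMap ℝ ℝ f ((1 - s : ℝ) • (p : ι → ℝ) + (s : ℝ) • (q : ι → ℝ)) = _
    rw [map_add, map_smul, map_smul]
    rfl

theorem FatRealisation.mk_face {X : SimplicialObject TopCat.{u}} {m n : ℕ}
    (φ : SimplexCategory.mk m ⟶ SimplexCategory.mk n) (hφ : Function.Injective φ.toOrderHom)
    (x : X.obj (op (.mk n))) (t : stdSimplex ℝ (Fin (m + 1))) :
    FatRealisation.mk x (stdSimplex.map φ.toOrderHom t) = FatRealisation.mk (X.map φ.op x) t :=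
  Quot.sound (FatRel.face φ hφ x t)

theorem FatRealisation.continuous_mk {X : SimplicialObject TopCat.{u}} {n : ℕ} :
    Continuous fun p : X.obj (op (.mk n)) × stdSimplex ℝ (Fin (n + 1)) =>
      FatRealisation.mk p.1 p.2 :=
  continuous_quot_mk.comp (continuous_sigmaMk (σ := fun n : ℕ =>
    X.obj (op (.mk n)) × stdSimplex ℝ (Fin (n + 1))))

theorem FatRealisation.ind {X : SimplicialObject TopCat.{u}} {p : FatRealisation X → Prop}
    (h : ∀ (n : ℕ) (x : X.obj (op (.mk n))) (t : stdSimplex ℝ (Fin (n + 1))), p (mk x t))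
    (z : FatRealisation X) : p z :=
  Quot.ind (fun y => h y.1 y.2.1 y.2.2) z

/-- Maps `D` from `n`-simplices of `X` to `N n`-simplices of `Y`, compatible with faces, give a
homotopy sweeping out the segments between the images of `Δⁿ` under two vertex maps
`a, b : [n] → [N n]`. -/
theorem homotopic_of_segments {X Y : SimplicialObject TopCat.{u}} (N : ℕ → ℕ)
    (a b : ∀ n, Fin (n + 1) → Fin (N n + 1))
    (D : ∀ n, C(X.obj (op (.mk n)), Y.obj (op (.mk (N n)))))
    (hD : ∀ {m n : ℕ} (φ : SimplexCategory.mk m ⟶ SimplexCategory.mk n),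
      Function.Injective φ.toOrderHom →
      ∃ ψ : SimplexCategory.mk (N m) ⟶ SimplexCategory.mk (N n),
        Function.Injective ψ.toOrderHom ∧ (∀ i, ψ.toOrderHom (a m i) = a n (φ.toOrderHom i)) ∧
        (∀ i, ψ.toOrderHom (b m i) = b n (φ.toOrderHom i)) ∧
        ∀ x, Y.map ψ.op (D n x) = D m (X.map φ.op x))
    (f g : C(FatRealisation X, FatRealisation Y))
    (hf : ∀ (n : ℕ) (x : X.obj (op (.mk n))) (t : stdSimplex ℝ (Fin (n + 1))),
      f (.mk x t) = .mk (D n x) (stdSimplex.map (a n) t))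
    (hg : ∀ (n : ℕ) (x : X.obj (op (.mk n))) (t : stdSimplex ℝ (Fin (n + 1))),
      g (.mk x t) = .mk (D n x) (stdSimplex.map (b n) t)) :
    f.Homotopic g := by
  let K (n : ℕ) : C((X.obj (op (.mk n)) × stdSimplex ℝ (Fin (n + 1))) × unitInterval,
      FatRealisation Y) :=
    ⟨fun p => .mk (D n p.1.1)
      (segment p.2 (stdSimplex.map (a n) p.1.2) (stdSimplex.map (b n) p.1.2)), by
      have ha := stdSimplex.continuous_map (S := ℝ) (a n)
      have hb := stdSimplex.continuous_map (S := ℝ) (b n)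
      refine FatRealisation.continuous_mk.comp (.prodMk (by fun_prop) ?_)
      exact continuous_segment.comp (continuous_snd.prodMk
        ((ha.comp (continuous_snd.comp continuous_fst)).prodMk
          (hb.comp (continuous_snd.comp continuous_fst))))⟩
  -- Currying the time variable lets the homotopy descend along the quotient map itself, so its
  -- product with the interval need not be examined; local compactness of the interval allows
  -- uncurrying afterwards.
  let F : C(FatRealisation X, C(unitInterval, FatRealisation Y)) :=
    ⟨Quot.lift (fun p : PreRealisation X => (K p.1).curry p.2) (by
      rintro _ _ ⟨φ, hφ, x, t⟩
      obtain ⟨ψ, hψ, hψa, hψb, hψD⟩ := hD φ hφ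
      ext s
      change FatRealisation.mk (D _ x) _ = FatRealisation.mk (D _ (X.map φ.op x)) _
      -- The simplex `D m` of the face is the `ψ`-face of `D n x`, and `ψ` carries its segment
      -- affinely onto the segment in the larger simplex.
      rw [← hψD, ← FatRealisation.mk_face ψ hψ]
      dsimp only
      rw [map_segment, stdSimplex.map_comp_apply, stdSimplex.map_comp_apply,
        stdSimplex.map_comp_apply, stdSimplex.map_comp_apply]
      congr 3
      · exact (funext hψa).symm
      · exact (funext hψb).symm),
      continuous_quot_lift _ (continuous_sigma fun n => (K n).curry.continuous)⟩
  refine ⟨⟨F.uncurry.comp ContinuousMap.prodSwap, fun z => ?_, fun z => ?_⟩⟩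
  · induction z using FatRealisation.ind with | h n x t => ?_
    rw [hf]
    change FatRealisation.mk (D n x) (segment 0 _ _) = _
    rw [segment_zero]
  · induction z using FatRealisation.ind with | h n x t => ?_
    rw [hg]
    change FatRealisation.mk (D n x) (segment 1 _ _) = _
    rw [segment_one]

/-! ### Normalisation of cocycles -/

namespace Cocycle

/-- The cocycle obtained from `c` by a change of representative with `w : Γ → H` and trivial
`γ`. -/
def twist (c : Cocycle Γ 𝒢) (w : Γ → 𝒢.H) : Cocycle Γ 𝒢 where
  α g := 𝒢.bd (w g) * c.α g
  u g h := w g * (c.α g • w h * c.u g h) * (w (g * h))⁻¹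
  mul_eq g h := by
    have := c.mul_eq g h
    simp only [map_mul, map_inv, 𝒢.bd_smul]
    rw [← mul_inv_eq_iff_eq_mul] at this
    rw [← this]
    group
  assoc g h k := by
    have h1 := c.assoc g h k
    -- Acting on `w k` by the two sides of the relation for `α g * α h` and using the Peiffer
    -- identity shows how `w k` moves past `u g h`.
    have h2 := congrArg (· • w k) (c.mul_eq g h)
    simp only [mul_smul, 𝒢.bd_act] at h2
    rw [← eq_mul_inv_iff_mul_eq] at h1
    simp only [mul_smul, smul_mul', smul_inv', 𝒢.bd_act, h1, h2]
    group

theorem cohomologous_twist (c : Cocycle Γ 𝒢) (w : Γ → 𝒢.H) : Cohomologous c (c.twist w) :=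
  ⟨1, w, by simp [twist], by simp [twist]⟩

theorem α_one (c : Cocycle Γ 𝒢) : c.α 1 = 𝒢.bd (c.u 1 1) := by
  simpa using c.mul_eq 1 1

/-- The cocycle identity at `(1, 1, g)` cancels to `α 1 • u 1 g = u 1 1`; since `α 1` acts as
conjugation by `u 1 1`, this conjugation can be undone. -/
theorem u_one_left (c : Cocycle Γ 𝒢) (g : Γ) : c.u 1 g = c.u 1 1 := by
  have h := c.assoc 1 1 g
  simp only [one_mul, mul_left_inj, c.α_one, 𝒢.bd_act] at h
  rwa [mul_inv_eq_iff_eq_mul, mul_right_inj] at h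

theorem u_one_right (c : Cocycle Γ 𝒢) (g : Γ) : c.u g 1 = c.α g • c.u 1 1 := by
  have h := c.assoc g 1 1
  simp only [mul_one, mul_left_inj] at h
  exact h.symm

/-- By the preceding formulas every defect of normalisation comes from `u 1 1`. Only the value of
`w` at `1` matters; the constant function is a convenient choice. -/
theorem normalised_twist (c : Cocycle Γ 𝒢) : (c.twist fun _ => (c.u 1 1)⁻¹).Normalised := by
  refine ⟨?_, fun g => ?_, fun g => ?_⟩
  · simp [twist, c.α_one]
  · simp [twist, c.u_one_right g]
  · simp [twist, c.u_one_left g, c.α_one, 𝒢.bd_act]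

theorem Normalised.pullback {c : Cocycle Γ 𝒢} (hc : c.Normalised) (φ : Γ' →* Γ) :
    (c.pullback φ).Normalised := by
  obtain ⟨h1, h2, h3⟩ := hc
  exact ⟨by simp [Cocycle.pullback, h1], by simp [Cocycle.pullback, h2],
    by simp [Cocycle.pullback, h3]⟩

theorem Normalised.map {c : Cocycle Γ 𝒢} (hc : c.Normalised) (Φ : CrossedModule.Hom 𝒢 𝒢') :
    (c.map Φ).Normalised := by
  obtain ⟨h1, h2, h3⟩ := hc
  exact ⟨by simp [Cocycle.map, h1], by simp [Cocycle.map, h2], by simp [Cocycle.map, h3]⟩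

theorem normalised_trivial (Γ : Type u) [Group Γ] (𝒢 : CrossedModule.{u}) :
    (trivial Γ 𝒢).Normalised := ⟨rfl, fun _ => rfl, fun _ => rfl⟩

end Cocycle

theorem H1.exists_normalised (x : H1 Γ 𝒢) : ∃ c : Cocycle Γ 𝒢, c.Normalised ∧ H1.mk c = x := by
  induction x using Quotient.ind with | _ c => ?_
  exact ⟨_, c.normalised_twist, Quotient.sound (c.cohomologous_twist _).symm⟩

/-! ### Gauge transformations of pseudofunctors -/

namespace Pseudofun

/-- The gauge transform of a pseudofunctor by elements of `G` at the objects and elements of `H` at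
the arrows. -/
def gauge {C : Type*} [Category C] (θ : Pseudofun C 𝒢) (γ : C → 𝒢.G)
    (w : ∀ {x y : C}, (x ⟶ y) → 𝒢.H) (hw : ∀ x : C, w (𝟙 x) = 1) : Pseudofun C 𝒢 where
  map {x y} f := 𝒢.bd (w f) * γ y * θ.map f * (γ x)⁻¹
  η {_ y z} f g := w g * γ z • (θ.map g • (γ y)⁻¹ • w f * θ.η f g) * (w (f ≫ g))⁻¹
  map_id x := by simp [hw, θ.map_id]
  target {x y z} f g := by
    have h := θ.target f g
    rw [← mul_inv_eq_iff_eq_mul] at h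
    simp only [map_mul, map_inv, 𝒢.bd_smul, ← h]
    group
  assoc {x y z t} f g h := by
    have h1 := θ.assoc f g h
    have h2 := congrArg (· • (γ y)⁻¹ • w f) (θ.target g h)
    simp only [mul_smul, 𝒢.bd_act] at h2
    rw [← eq_mul_inv_iff_mul_eq] at h1
    simp only [mul_smul, smul_mul', smul_inv', 𝒢.bd_act, inv_smul_smul, h1, h2, Category.assoc]
    group
  id_η f := by simp [hw, θ.id_η]
  η_id f := by simp [hw, θ.η_id, θ.map_id]

end Pseudofun

/-- For a functor `σ : [k] → C_Γ` and a subset `e` of the vertices, the simplex of the Duskin nerve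
interpolating between a cocycle `c` and its transform under `(γ, w)`: the latter is used on the
vertices in `e`. -/
def mixedSimplex (c : Cocycle Γ 𝒢) (hc : c.Normalised) (γ : 𝒢.G) (w : Γ → 𝒢.H) (hw : w 1 = 1)
    {k : SimplexCategory} (σ : Ord k ⥤ SingleObj Γ) (e : Ord k → Bool) : Pseudofun (Ord k) 𝒢 :=
  (Pseudofun.precomp σ (Pseudofun.ofCocycle c hc)).gauge (fun x => bif e x then γ else 1)
    -- An arrow with exactly one end in `e` gets no `w`, only `γ` at that end; this choice is
    -- harmless, as only the values on identities are constrained.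
    (fun {x y} f => bif e x && e y then w (σ.map f) else 1) (fun x => by
      rw [σ.map_id]
      cases e x
      · rfl
      · exact hw)

section

variable (c : Cocycle Γ 𝒢) (hc : c.Normalised) (γ : 𝒢.G) (w : Γ → 𝒢.H) (hw : w 1 = 1)

/-- All data are read off vertex by vertex and arrow by arrow. Face compatibility thus reduces to
combinatorics of the merging map and of parity. -/
theorem mixedSimplex_precomp {k l : SimplexCategory} (f : l ⟶ k) (σ : Ord k ⥤ SingleObj Γ)
    (e : Ord k → Bool) :
    (mixedSimplex c hc γ w hw σ e).precomp (ordFunctor f) =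
      mixedSimplex c hc γ w hw (ordFunctor f ⋙ σ) (fun x => e ((ordFunctor f).obj x)) :=
  rfl

theorem mixedSimplex_false {k : SimplexCategory} (σ : Ord k ⥤ SingleObj Γ) :
    mixedSimplex c hc γ w hw σ (fun _ => false) =
      Pseudofun.precomp σ (Pseudofun.ofCocycle c hc) := by
  ext <;> simp [mixedSimplex, Pseudofun.gauge]

/-- When all vertices are selected, the gauge formulas are the relation of being cohomologous,
evaluated on the arrows of `σ`. -/
theorem mixedSimplex_true (c₁ : Cocycle Γ 𝒢) (hc₁ : c₁.Normalised)
    (h1 : ∀ g, c₁.α g = 𝒢.bd (w g) * γ * c.α g * γ⁻¹)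
    (h2 : ∀ g h, c₁.u g h = w g * γ • (c.α g • γ⁻¹ • w h * c.u g h) * (w (g * h))⁻¹)
    {k : SimplexCategory} (σ : Ord k ⥤ SingleObj Γ) :
    mixedSimplex c hc γ w hw σ (fun _ => true) =
      Pseudofun.precomp σ (Pseudofun.ofCocycle c₁ hc₁) := by
  ext x y f
  · exact (h1 _).symm
  · refine Eq.trans ?_ (h2 _ _).symm
    simp only [mixedSimplex, Pseudofun.gauge, Functor.map_comp]
    rfl

end

/-! ### Doubling the vertices of a simplex -/

/-- The vertex `2 i` of the doubled simplex. -/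
def evenVertex (n : ℕ) : SimplexCategory.mk n ⟶ SimplexCategory.mk (2 * n + 1) :=
  SimplexCategory.Hom.mk (OrderHom.mk (α := Fin (n + 1)) (β := Fin (2 * n + 1 + 1))
    (fun i => ⟨2 * i, by omega⟩) fun i j h => by simp only [Fin.le_def] at h ⊢; omega)

/-- The vertex `2 i + 1` of the doubled simplex. -/
def oddVertex (n : ℕ) : SimplexCategory.mk n ⟶ SimplexCategory.mk (2 * n + 1) :=
  SimplexCategory.Hom.mk (OrderHom.mk (α := Fin (n + 1)) (β := Fin (2 * n + 1 + 1))
    (fun i => ⟨2 * i + 1, by omega⟩) fun i j h => by simp only [Fin.le_def] at h ⊢; omega)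

/-- The vertex map that identifies `2 i` with `2 i + 1`. -/
def half {n : ℕ} (i : Fin (2 * n + 1 + 1)) : Fin (n + 1) := ⟨i / 2, by omega⟩

theorem val_half {n : ℕ} (i : Fin (2 * n + 1 + 1)) : (half i : ℕ) = i / 2 := rfl

/-- The map from the doubled simplex that identifies `2 i` with `2 i + 1`. -/
def halve (n : ℕ) : SimplexCategory.mk (2 * n + 1) ⟶ SimplexCategory.mk n :=
  SimplexCategory.Hom.mk (OrderHom.mk (α := Fin (2 * n + 1 + 1)) (β := Fin (n + 1)) half
    fun i j h => by rw [Fin.le_def] at h ⊢; rw [val_half, val_half]; omega)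

/-- The doubling of an injective monotone map. -/
def double {m n : ℕ} (φ : SimplexCategory.mk m ⟶ SimplexCategory.mk n)
    (hφ : Function.Injective φ.toOrderHom) :
    SimplexCategory.mk (2 * m + 1) ⟶ SimplexCategory.mk (2 * n + 1) :=
  SimplexCategory.Hom.mk (OrderHom.mk (α := Fin (2 * m + 1 + 1)) (β := Fin (2 * n + 1 + 1))
    (fun i => ⟨2 * (φ.toOrderHom (half i) : Fin (n + 1)) + i % 2, by
      have := Fin.isLt (n := n + 1) (φ.toOrderHom (half i))
      omega⟩) fun i j h => by
      rw [Fin.le_def] at h ⊢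
      dsimp only
      -- Injectivity enters here: a strict increase of `φ` is doubled to at least `2`, which absorbs
      -- a drop of parity from `1` to `0`. A merely monotone `φ` could reverse the order.
      rcases Nat.lt_or_ge ((i : ℕ) / 2) (j / 2) with hlt | hge
      · have h' : half i < half j := hlt
        have h'' : (φ.toOrderHom (half i) : Fin (n + 1)).val <
            (φ.toOrderHom (half j) : Fin (n + 1)).val :=
          φ.toOrderHom.monotone.strictMono_of_injective hφ h'
        omega
      · have h' : half i = half j := Fin.ext (by rw [val_half, val_half]; omega)
        rw [h']
        omega)

theorem double_apply {m n : ℕ} (φ : SimplexCategory.mk m ⟶ SimplexCategory.mk n)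
    (hφ : Function.Injective φ.toOrderHom) (i : Fin (2 * m + 1 + 1)) :
    ((double φ hφ).toOrderHom i : Fin (2 * n + 1 + 1)).val =
      2 * (φ.toOrderHom (half i) : Fin (n + 1)).val + i.val % 2 :=
  rfl

theorem double_injective {m n : ℕ} (φ : SimplexCategory.mk m ⟶ SimplexCategory.mk n)
    (hφ : Function.Injective φ.toOrderHom) : Function.Injective (double φ hφ).toOrderHom := by
  intro (i : Fin (2 * m + 1 + 1)) (j : Fin (2 * m + 1 + 1)) h
  have h1 := congrArg (Fin.val (n := 2 * n + 1 + 1)) h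
  rw [double_apply, double_apply] at h1
  have h2 : φ.toOrderHom (half i) = φ.toOrderHom (half j) := Fin.ext (n := n + 1) (by omega)
  have h3 := congrArg Fin.val (hφ h2 : half i = half j)
  rw [val_half, val_half] at h3
  exact Fin.ext (by omega)

/-- Together with preservation of parity, this makes the mixed simplices compatible with faces. -/
theorem double_halve {m n : ℕ} (φ : SimplexCategory.mk m ⟶ SimplexCategory.mk n)
    (hφ : Function.Injective φ.toOrderHom) : double φ hφ ≫ halve n = halve m ≫ φ := by
  ext i : 3
  refine Fin.ext (n := n + 1) ?_
  have h := double_apply φ hφ i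
  change ((double φ hφ).toOrderHom i : Fin (2 * n + 1 + 1)).val / 2 =
    (φ.toOrderHom (half i) : Fin (n + 1)).val
  omega

theorem double_evenVertex {m n : ℕ} (φ : SimplexCategory.mk m ⟶ SimplexCategory.mk n)
    (hφ : Function.Injective φ.toOrderHom) (i : Fin (m + 1)) :
    (double φ hφ).toOrderHom ((evenVertex m).toOrderHom i) =
      (evenVertex n).toOrderHom (φ.toOrderHom i) := by
  have h : half ((evenVertex m).toOrderHom i) = i :=
    Fin.ext (by change 2 * i.val / 2 = i.val; omega)
  refine Fin.ext (n := 2 * n + 1 + 1) ?_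
  rw [double_apply, h]
  change 2 * (φ.toOrderHom i : Fin (n + 1)).val + 2 * i.val % 2 =
    2 * (φ.toOrderHom i : Fin (n + 1)).val
  omega

theorem double_oddVertex {m n : ℕ} (φ : SimplexCategory.mk m ⟶ SimplexCategory.mk n)
    (hφ : Function.Injective φ.toOrderHom) (i : Fin (m + 1)) :
    (double φ hφ).toOrderHom ((oddVertex m).toOrderHom i) =
      (oddVertex n).toOrderHom (φ.toOrderHom i) := by
  have h : half ((oddVertex m).toOrderHom i) = i :=
    Fin.ext (by change (2 * i.val + 1) / 2 = i.val; omega)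
  refine Fin.ext (n := 2 * n + 1 + 1) ?_
  rw [double_apply, h]
  change 2 * (φ.toOrderHom i : Fin (n + 1)).val + (2 * i.val + 1) % 2 =
    2 * (φ.toOrderHom i : Fin (n + 1)).val + 1
  omega

theorem evenVertex_injective (n : ℕ) : Function.Injective (evenVertex n).toOrderHom := by
  intro i j h
  have h1 : 2 * (i : Fin (n + 1)).val = 2 * (j : Fin (n + 1)).val :=
    congrArg (Fin.val (n := 2 * n + 1 + 1)) h
  exact Fin.ext (n := n + 1) (by omega)

theorem oddVertex_injective (n : ℕ) : Function.Injective (oddVertex n).toOrderHom := by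
  intro i j h
  have h1 : 2 * (i : Fin (n + 1)).val + 1 = 2 * (j : Fin (n + 1)).val + 1 :=
    congrArg (Fin.val (n := 2 * n + 1 + 1)) h
  exact Fin.ext (n := n + 1) (by omega)

theorem evenVertex_halve (n : ℕ) : evenVertex n ≫ halve n = 𝟙 _ := by
  ext i : 3
  refine Fin.ext (n := n + 1) ?_
  change 2 * (i : Fin (n + 1)).val / 2 = (i : Fin (n + 1)).val
  omega

theorem oddVertex_halve (n : ℕ) : oddVertex n ≫ halve n = 𝟙 _ := by
  ext i : 3
  refine Fin.ext (n := n + 1) ?_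
  change (2 * (i : Fin (n + 1)).val + 1) / 2 = (i : Fin (n + 1)).val
  omega

/-- The set of odd vertices of the doubled simplex. -/
def isOdd {n : ℕ} (x : Ord (.mk (2 * n + 1))) : Bool :=
  decide ((OrderDual.ofDual x : Fin (2 * n + 1 + 1)).val % 2 = 1)

theorem isOdd_evenVertex {n : ℕ} (x : Ord (.mk n)) :
    isOdd ((ordFunctor (evenVertex n)).obj x) = false := by
  change decide (2 * (OrderDual.ofDual x : Fin (n + 1)).val % 2 = 1) = false
  simp

theorem isOdd_oddVertex {n : ℕ} (x : Ord (.mk n)) :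
    isOdd ((ordFunctor (oddVertex n)).obj x) = true := by
  change decide ((2 * (OrderDual.ofDual x : Fin (n + 1)).val + 1) % 2 = 1) = true
  simp

theorem isOdd_double {m n : ℕ} (φ : SimplexCategory.mk m ⟶ SimplexCategory.mk n)
    (hφ : Function.Injective φ.toOrderHom) (x : Ord (.mk (2 * m + 1))) :
    isOdd ((ordFunctor (double φ hφ)).obj x) = isOdd x := by
  unfold isOdd
  congr 2
  have := double_apply φ hφ (OrderDual.ofDual x)
  change ((double φ hφ).toOrderHom (OrderDual.ofDual x) : Fin (2 * n + 1 + 1)).val % 2 = _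
  omega

/-! ### The homotopies -/

theorem Cocycle.Cohomologous.realise_homotopic {c₀ c₁ : Cocycle Γ 𝒢} (h : c₀.Cohomologous c₁)
    (h₀ : c₀.Normalised) (h₁ : c₁.Normalised) : (realise c₀ h₀).Homotopic (realise c₁ h₁) := by
  obtain ⟨γ, w, hα, hu⟩ := h
  -- With both cocycles normalised, the relation at `(1, 1)` collapses to `1 = w 1 * w 1 * (w 1)⁻¹`.
  have hw : w 1 = 1 := by
    have h := hu 1 1
    rw [h₁.2.1, h₀.2.1, h₀.1] at h
    simpa using h.symm
  -- Continuity is free because the nerve of `Γ` is discrete.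
  let D (n : ℕ) : C((nerveGroup Γ).obj (op (.mk n)), (duskinNerve 𝒢).obj (op (.mk (2 * n + 1)))) :=
    @ContinuousMap.mk _ _ ⊥ _
      (fun σ => mixedSimplex c₀ h₀ γ w hw (ordFunctor (halve n) ⋙ σ) isOdd) continuous_bot
  refine homotopic_of_segments (fun n => 2 * n + 1) (fun n => (evenVertex n).toOrderHom)
    (fun n => (oddVertex n).toOrderHom) D ?_ _ _ ?_ ?_
  · intro m n φ hφ
    refine ⟨double φ hφ, double_injective φ hφ, double_evenVertex φ hφ, double_oddVertex φ hφ,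
      fun σ => ?_⟩
    change (mixedSimplex c₀ h₀ γ w hw (ordFunctor (halve n) ⋙ σ) isOdd).precomp
      (ordFunctor (double φ hφ)) =
        mixedSimplex c₀ h₀ γ w hw (ordFunctor (halve m ≫ φ) ⋙ σ) isOdd
    rw [mixedSimplex_precomp, funext (isOdd_double φ hφ), ← double_halve φ hφ]
    rfl
  · intro n σ t
    rw [FatRealisation.mk_face _ (evenVertex_injective n)]
    change FatRealisation.mk (X := duskinNerve 𝒢)
      (Pseudofun.precomp σ (Pseudofun.ofCocycle c₀ h₀)) t = FatRealisation.mk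
        ((mixedSimplex c₀ h₀ γ w hw (ordFunctor (halve n) ⋙ σ) isOdd).precomp
          (ordFunctor (evenVertex n))) t
    rw [mixedSimplex_precomp, funext isOdd_evenVertex, mixedSimplex_false]
    change _ = FatRealisation.mk (X := duskinNerve 𝒢)
      (Pseudofun.precomp (ordFunctor (evenVertex n ≫ halve n) ⋙ σ) _) t
    rw [evenVertex_halve]
    rfl
  · intro n σ t
    rw [FatRealisation.mk_face _ (oddVertex_injective n)]
    change FatRealisation.mk (X := duskinNerve 𝒢)
      (Pseudofun.precomp σ (Pseudofun.ofCocycle c₁ h₁)) t = FatRealisation.mk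
        ((mixedSimplex c₀ h₀ γ w hw (ordFunctor (halve n) ⋙ σ) isOdd).precomp
          (ordFunctor (oddVertex n))) t
    rw [mixedSimplex_precomp, funext isOdd_oddVertex, mixedSimplex_true (hc₁ := h₁) (h1 := hα)
      (h2 := hu)]
    change _ = FatRealisation.mk (X := duskinNerve 𝒢)
      (Pseudofun.precomp (ordFunctor (oddVertex n ≫ halve n) ⋙ σ) _) t
    rw [oddVertex_halve]
    rfl

/-! ### Cones and the base point -/

/-- The extension of a map of vertices that preserves the last vertex. -/
def extendLast {m n : ℕ} (f : Fin (m + 1) → Fin (n + 1)) : Fin (m + 1 + 1) → Fin (n + 1 + 1) :=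
  Fin.lastCases (Fin.last (n + 1)) fun i => (f i).castSucc

theorem extendLast_castSucc {m n : ℕ} (f : Fin (m + 1) → Fin (n + 1)) (i : Fin (m + 1)) :
    extendLast f i.castSucc = (f i).castSucc := by
  simp [extendLast]

theorem extendLast_last {m n : ℕ} (f : Fin (m + 1) → Fin (n + 1)) :
    extendLast f (Fin.last (m + 1)) = Fin.last (n + 1) := by
  simp [extendLast]

theorem strictMono_extendLast {m n : ℕ} {f : Fin (m + 1) → Fin (n + 1)} (hf : StrictMono f) :
    StrictMono (extendLast f) := by
  intro i j h
  induction i using Fin.lastCases with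
  | last => exact absurd h (Fin.le_last j).not_gt
  | cast i =>
    rw [extendLast_castSucc]
    induction j using Fin.lastCases with
    | last =>
      rw [extendLast_last]
      exact Fin.castSucc_lt_last _
    | cast j =>
      rw [extendLast_castSucc]
      exact hf h

theorem realise_trivial_homotopic (Γ : Type u) [Group Γ] (𝒢 : CrossedModule.{u}) :
    (realise (Cocycle.trivial Γ 𝒢) (Cocycle.normalised_trivial Γ 𝒢)).Homotopic
      (ContinuousMap.const (B Γ) (BD.basepoint 𝒢)) := by
  let base (n : ℕ) : SimplexCategory.mk n ⟶ SimplexCategory.mk (n + 1) :=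
    SimplexCategory.Hom.mk Fin.castSuccOrderEmb.toOrderHom
  let apex (n : ℕ) : SimplexCategory.mk 0 ⟶ SimplexCategory.mk (n + 1) :=
    SimplexCategory.Hom.mk ⟨fun _ => Fin.last (n + 1), fun _ _ _ => le_rfl⟩
  refine homotopic_of_segments (fun n => n + 1) (fun n => Fin.castSucc) (fun n _ => Fin.last _)
    (fun n => .const _ (Pseudofun.const (Ord (.mk (n + 1))) 𝒢)) ?_ _ _ ?_ ?_
  · intro m n φ hφ
    have h := strictMono_extendLast (φ.toOrderHom.monotone.strictMono_of_injective hφ)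
    exact ⟨SimplexCategory.Hom.mk ⟨_, h.monotone⟩, h.injective, extendLast_castSucc _,
      fun _ => extendLast_last _, fun _ => rfl⟩
  · intro n σ t
    exact (FatRealisation.mk_face (X := duskinNerve 𝒢) (base n) (Fin.castSucc_injective _)
      (Pseudofun.const (Ord (.mk (n + 1))) 𝒢) t).symm
  · intro n σ t
    have h := FatRealisation.mk_face (X := duskinNerve 𝒢) (apex n)
      (fun i j _ => Subsingleton.elim (α := Fin 1) i j)
      (Pseudofun.const (Ord (.mk (n + 1))) 𝒢) default
    -- The apex inclusion factors through `Δ⁰`, a single point, so the end of the homotopy does not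
    -- depend on `t`.
    have ht : stdSimplex.map (fun _ => 0) t = (default : stdSimplex ℝ (Fin (0 + 1))) :=
      Subsingleton.elim _ _
    rw [← ht, stdSimplex.map_comp_apply, ht] at h
    exact h.symm

/-! ### The map on cohomology -/

theorem H1.mk_eq_mk {c₀ c₁ : Cocycle Γ 𝒢} : H1.mk c₀ = H1.mk c₁ ↔ c₀.Cohomologous c₁ :=
  ⟨fun h => Quotient.exact h, fun h => Quotient.sound h⟩

/-- The map `H¹(Γ, 𝒢) → [BΓ, B^D 𝒢]` given by realisation of normalised cocycles. -/
noncomputable def H1.realise (x : H1 Γ 𝒢) : HomotopySet (B Γ) (BD 𝒢) :=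
  HomotopySet.mk (XMod.realise x.exists_normalised.choose x.exists_normalised.choose_spec.1)

/-- The chosen normalised representative is cohomologous to `c`, so homotopy invariance makes the
choice irrelevant. -/
theorem H1.realise_mk (c : Cocycle Γ 𝒢) (hc : c.Normalised) :
    (H1.mk c).realise = HomotopySet.mk (XMod.realise c hc) :=
  Quotient.sound ((H1.mk_eq_mk.1 (H1.mk c).exists_normalised.choose_spec.2).realise_homotopic _ _)

/-- Both sides send a point of a simplex to the same simplex with the same coordinates, since
precomposition of pseudofunctors is strictly associative. -/
theorem realise_pullback (φ : Γ' →* Γ) (c : Cocycle Γ 𝒢) (hc : c.Normalised) :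
    realise (c.pullback φ) (hc.pullback φ) = (realise c hc).comp (B.map φ) := by
  ext z
  induction z using FatRealisation.ind
  rfl

theorem realise_map (Φ : CrossedModule.Hom 𝒢 𝒢') (c : Cocycle Γ 𝒢) (hc : c.Normalised) :
    realise (c.map Φ) (hc.map Φ) = (BD.map Φ).comp (realise c hc) := by
  ext z
  induction z using FatRealisation.ind
  rfl

end XMod

theorem mainTheorem6 :
    -- every class is represented by a normalised cocycle, and cohomologous normalised cocycles
    -- have homotopic realisations
    (∀ (Γ : Type u) [Group Γ] (𝒢 : XMod.CrossedModule.{u}),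
      (∀ x : XMod.H1 Γ 𝒢, ∃ c : XMod.Cocycle Γ 𝒢, c.Normalised ∧ XMod.H1.mk c = x) ∧
      ∀ (c₀ c₁ : XMod.Cocycle Γ 𝒢) (h₀ : c₀.Normalised) (h₁ : c₁.Normalised),
        c₀.Cohomologous c₁ → (XMod.realise c₀ h₀).Homotopic (XMod.realise c₁ h₁)) ∧
    -- the resulting map is pointed and natural in both variables
    ∃ Ψ : ∀ (Γ : Type u) [Group Γ] (𝒢 : XMod.CrossedModule.{u}),
        XMod.H1 Γ 𝒢 → XMod.HomotopySet (XMod.B Γ) (XMod.BD 𝒢),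
      (∀ (Γ : Type u) [Group Γ] (𝒢 : XMod.CrossedModule.{u})
        (c : XMod.Cocycle Γ 𝒢) (hc : c.Normalised),
        Ψ Γ 𝒢 (XMod.H1.mk c) = XMod.HomotopySet.mk (XMod.realise c hc)) ∧
      (∀ (Γ : Type u) [Group Γ] (𝒢 : XMod.CrossedModule.{u}),
        Ψ Γ 𝒢 (XMod.H1.basepoint Γ 𝒢) =
          XMod.HomotopySet.const (XMod.B Γ) (XMod.BD.basepoint 𝒢)) ∧
      (∀ (Γ Γ' : Type u) [Group Γ] [Group Γ'] (φ : Γ' →* Γ) (𝒢 : XMod.CrossedModule.{u})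
        (x : XMod.H1 Γ 𝒢),
        Ψ Γ' 𝒢 (XMod.H1.pullback φ x) = XMod.HomotopySet.precomp (XMod.B.map φ) (Ψ Γ 𝒢 x)) ∧
      (∀ (Γ : Type u) [Group Γ] (𝒢 𝒢' : XMod.CrossedModule.{u})
        (Φ : XMod.CrossedModule.Hom 𝒢 𝒢') (x : XMod.H1 Γ 𝒢),
        Ψ Γ 𝒢' (XMod.H1.map Φ x) = XMod.HomotopySet.postcomp (XMod.BD.map Φ) (Ψ Γ 𝒢 x)) := by
  refine ⟨fun Γ _ 𝒢 => ⟨fun x => x.exists_normalised,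
    fun _ _ h₀ h₁ h => h.realise_homotopic h₀ h₁⟩, fun _ _ _ => XMod.H1.realise,
    fun _ _ _ => XMod.H1.realise_mk, fun Γ _ 𝒢 => ?_, fun _ _ _ _ φ _ x => ?_,
    fun _ _ _ _ Φ x => ?_⟩
  · exact (XMod.H1.realise_mk _ (XMod.Cocycle.normalised_trivial Γ 𝒢)).trans
      (Quotient.sound (XMod.realise_trivial_homotopic Γ 𝒢))
  -- Pullback preserves normalisation, so one normalised representative computes both sides.
  · obtain ⟨c, hc, rfl⟩ := x.exists_normalised
    beta_reduce
    rw [XMod.H1.realise_mk c hc]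
    refine (XMod.H1.realise_mk _ (hc.pullback φ)).trans ?_
    rw [XMod.realise_pullback]
    rfl
  · obtain ⟨c, hc, rfl⟩ := x.exists_normalised
    beta_reduce
    rw [XMod.H1.realise_mk c hc]
    refine (XMod.H1.realise_mk _ (hc.map Φ)).trans ?_
    rw [XMod.realise_map]
    rfl
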